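/- **Setting.** Let $N\cong\mathbb{Z}^n$ and $M$ be dual lattices with pairing $\langle\cdot,\cdot\rangle$, let $\sigma\subset N_{\mathbb R}$ be a strongly convex rational polyhedral cone with dual cone $\sigma^\vee\subset M_{\mathbb R}$, let $k$ be a field and $R=k[\sigma^\vee\cap M]$. Let $\sigma(1)$ be the set of rays of $\sigma$, $u_\rho\in N$ the primitive generator of $\rho\in\sigma(1)$ and $D_\rho$ the corresponding torus-invariant divisor. *Conic modules.* For $v\in M_{\mathbb R}$ let $A_v=\operatorname{Span}_k\{x^m: m\in M\cap(\sigma^\vee+v)\}$ and $\mathring A_v=\operatorname{Span}_k\{x^m: m\in M\cap(\operatorname{int}(\sigma^\vee)+v)\}$, as $R$-submodules of $k[M]$. The chamber of constancy of $v$ is $\Delta_v=\{w\in M_{\mathbb R}: A_w=A_v\}$. Two points $x,y\in M_{\mathbb R}$ lie in the same open cell iff $A_x=A_y$ and $\mathring A_x=\mathring A_y$; for an open cell $\tau$ write $\mathring A_\tau=\mathring A_x$ for any $x\in\tau$. The complex $K_v^\bullet$ has in degree $l$ the term $\bigoplus_\tau\mathring A_\tau$, over the open cells $\tau\subset\Delta_v$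 of codimension $l$. The isomorphism class of $A_w$ *appears in $K_v^\bullet$ in degree $l$* if $A_w$ is isomorphic as an $R$-module to one of the summands $\mathring A_\tau$ of the term of degree $l$; it *appears in $K_v^\bullet$* if it does so in some degree. *Divisors and paths.* Let $f_\sigma:\bigoplus_{\rho\in\sigma(1)}\mathbb R D_\rho\to \mathrm{Cl}_{\mathbb R}$ be the cokernel of $M_{\mathbb R}\to\bigoplus_\rho\mathbb R D_\rho$, $x\mapsto\sum_\rho\langle x,u_\rho\rangle D_\rho$, and let $\beta_\rho=f_\sigma(D_\rho)$. For integral divisors, $D\sim E$ means $D-E=\sum_\rho\langle m,u_\rho\rangle D_\rho$ for some $m\in M$. For $v\in M_{\mathbb R}$ put $-d(v)=\sum_\rho\lfloor\langle -v,u_\rho\rangle\rfloor D_\rho$. Let $Z$ be the half-open zonotope $f_\sigma((-1,0]^{\sigma(1)})$; its lattice points are the elements of $Z\cap f_\sigma(\mathbb Z^{\sigma(1)})$. For lattice points $P_1,P_2$ of $Z$, a *path* $\beta_J$ from $P_1$ to $P_2$ is given by a subset $J\subset\sigma(1)$ with $P_1+\sum_{\rho\in J}\beta_\rho=P_2$;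 its *length* is $\operatorname{rk}(A_J)$, where $A_J$ is the matrix with rows $u_\rho$, $\rho\in J$. Writing $P_2=\sum_{\rho\in\sigma(1)}\alpha_\rho\beta_\rho$ with $\alpha_\rho\in\mathbb Q$, the path is *valid* if $$\sum_{\rho\in J}\alpha_\rho\beta_\rho\in\sum_{\rho\notin J}\{\gamma\beta_\rho:\gamma\in(-\alpha_\rho-1,-\alpha_\rho)\},$$ where the right-hand side is a Minkowski sum, equal to $\{0\}$ if $J=\sigma(1)$. (This does not depend on the choice of the $\alpha_\rho$.) **Proposition.** Let $v\in M_{\mathbb R}$. 1. For every $P_1\in\mathrm{Cl}_{\mathbb R}$: $P_1$ is a lattice point of $Z$ from which there is a valid path to $f_\sigma(-d(v))$ if and only if there is a $w\in M_{\mathbb R}$ such that the isomorphism class of $A_w$ appears in $K_v^\bullet$ and $P_1=f_\sigma(-d(w))$. 2. Let $\beta_J$ be a valid path from $P_1$ to $f_\sigma(-d(v))$. Then there is a $w\in M_{\mathbb R}$ with $-d(w)\sim-d(v)-\sum_{\rho\in J}D_\rho$, and for every such $w$ one has $P_1=f_\sigma(-d(w))$, and the isomorphism class of $A_w$ appears in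 $K_v^\bullet$ in degree equal to the length $\operatorname{rk}(A_J)$ of $\beta_J$. 3. Conversely, if the isomorphism class of $A_w$ appears in $K_v^\bullet$ in degree $l$, then there is a valid path $\beta_J$ of length $l$ from $f_\sigma(-d(w))$ to $f_\sigma(-d(v))$ with $-d(w)\sim-d(v)-\sum_{\rho\in J}D_\rho$. -/

import Mathlib

open scoped Pointwise DirectSum

/-- A strongly convex rational polyhedral cone `σ` in `N_ℝ = ℝⁿ`, for the lattice `N = ℤⁿ`.
The dual lattice is `M = ℤⁿ`, paired with `N` by the dot product. -/
structure ToricCone (n : ℕ) where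
  toPointedCone : PointedCone ℝ (Fin n → ℝ)
  rational : ∃ S : Finset (Fin n → ℤ),
    toPointedCone = PointedCone.hull ℝ ((fun (u : Fin n → ℤ) (i : Fin n) => (u i : ℝ)) '' ↑S)
  salient : (toPointedCone : ConvexCone ℝ (Fin n → ℝ)).Salient

namespace ToricCone

/-- The inclusion of the lattice `ℤⁿ` in `ℝⁿ`. -/
def toReal {n : ℕ} (m : Fin n → ℤ) : Fin n → ℝ := fun i => (m i : ℝ)

/-- A primitive lattice vector (in particular it is nonzero). -/
def IsPrimitive {n : ℕ} (u : Fin n → ℤ) : Prop :=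
  ∀ (d : ℤ) (w : Fin n → ℤ), u = d • w → IsUnit d

/-- Two primitive vectors on the same ray are equal. -/
theorem IsPrimitive.eq_of_smul {n : ℕ} {u w : Fin n → ℤ} (hu : IsPrimitive u)
    (hw : IsPrimitive w) {r : ℝ} (hr : 0 < r) (h : toReal w = r • toReal u) : w = u := by
  have hb : ∃ c : Fin n → ℤ, ∑ i, c i * u i = 1 := by
    obtain ⟨d, hd⟩ := (inferInstance : (Ideal.span (Set.range u)).IsPrincipal)
    have hdvd : ∀ i, d ∣ u i := fun i => by
      rw [← Ideal.mem_span_singleton]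
      have : u i ∈ Ideal.span (Set.range u) := Ideal.subset_span ⟨i, rfl⟩
      rw [hd] at this
      exact this
    choose c hc using hdvd
    have hunit : IsUnit d := hu d c (by ext i; simp [hc i])
    have h1 : (1 : ℤ) ∈ Ideal.span (Set.range u) := by
      have : Ideal.span (Set.range u) = ⊤ := by
        rw [hd]
        exact Ideal.span_singleton_eq_top.2 hunit
      rw [this]
      trivial
    rw [Ideal.mem_span_range_iff_exists_fun] at h1
    exact h1
  obtain ⟨c, hc⟩ := hb
  have hi : ∀ i, (w i : ℝ) = r * u i := fun i => congrFun h i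
  have hrz : r = ((∑ i, c i * w i : ℤ) : ℝ) := by
    have h2 : ((∑ i, c i * u i : ℤ) : ℝ) = 1 := by exact_mod_cast hc
    push_cast at h2 ⊢
    simp only [hi]
    calc r = r * ∑ i, (c i : ℝ) * u i := by rw [h2, mul_one]
      _ = ∑ i, (c i : ℝ) * (r * u i) := by
        rw [Finset.mul_sum]
        exact Finset.sum_congr rfl fun i _ => by ring
  obtain ⟨z, hz⟩ : ∃ z : ℤ, r = z := ⟨_, hrz⟩
  have hwz : w = z • u := by
    ext i
    have := hi i
    rw [hz] at this
    simpa using (by exact_mod_cast this : w i = z * u i)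
  have hzu := hw z u hwz
  have hz0 : 0 < z := by
    rw [hz] at hr
    exact_mod_cast hr
  have : z = 1 := by
    rcases Int.isUnit_iff.1 hzu with h | h <;> omega
  rw [hwz, this, one_smul]

variable {n : ℕ} (σ : ToricCone n)

/-- The set `σ(1)` of rays (one-dimensional faces) of `σ`, each ray `ρ` being recorded by its
primitive generator `u_ρ ∈ N`. -/
def rays : Set (Fin n → ℤ) :=
  {u | IsPrimitive u ∧ (PointedCone.hull ℝ {toReal u}).IsFaceOf σ.toPointedCone}

theorem rays_finite : σ.rays.Finite := by
  obtain ⟨S, hS⟩ := σ.rational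
  have key : ∀ u ∈ σ.rays, ∃ s ∈ S, ∃ t : ℝ, 0 < t ∧ toReal s = t • toReal u := by
    rintro u ⟨hprim, hface⟩
    by_contra! hno
    have hu : toReal u ∈ σ.toPointedCone :=
      hface.le (PointedCone.subset_hull (Set.mem_singleton _))
    have hu0 : toReal u ≠ 0 := by
      intro h0
      have hz : u = (0 : ℤ) • u := by
        ext i
        have := congrFun h0 i
        simpa [toReal] using this
      simpa using hprim 0 u hz
    rw [hS, PointedCone.hull, ← Finset.coe_image, Submodule.mem_span_finset] at hu
    obtain ⟨c, -, hc⟩ := hu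
    refine hu0 ?_
    rw [← hc]
    refine Finset.sum_eq_zero fun y hy => ?_
    obtain ⟨s, hs, rfl⟩ := Finset.mem_image.1 hy
    by_contra hne
    have hmemS : ∀ y ∈ S.image (fun (u : Fin n → ℤ) (i : Fin n) => (u i : ℝ)),
        c y • y ∈ σ.toPointedCone := fun y hy => by
      refine Submodule.smul_mem _ _ ?_
      rw [hS]
      exact PointedCone.subset_hull (by rw [← Finset.coe_image]; exact hy)
    have hsum := Finset.add_sum_erase _ (fun y => c y • y) hy
    have hin := hface.mem_of_add_mem_left (hmemS _ hy)
      (Submodule.sum_mem _ fun y hy' => hmemS y (Finset.mem_of_mem_erase hy'))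
      (by rw [hsum, hc]; exact PointedCone.subset_hull (Set.mem_singleton _))
    rw [PointedCone.hull, Submodule.mem_span_singleton] at hin
    obtain ⟨b, hb⟩ := hin
    have hcne : c (toReal s) ≠ 0 := fun h => hne (by
      change c (toReal s) • toReal s = 0
      rw [h, zero_smul])
    have hcpos : (0 : ℝ) < (c (toReal s) : ℝ) :=
      lt_of_le_of_ne (c (toReal s)).2 fun h => hcne (Subtype.ext h.symm)
    have hbne : b ≠ 0 := fun h => hne (by rw [← hb, h, zero_smul])
    have hbpos : (0 : ℝ) < (b : ℝ) := lt_of_le_of_ne b.2 fun h => hbne (Subtype.ext h.symm)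
    have hb' : (b : ℝ) • toReal u = (c (toReal s) : ℝ) • toReal s := hb
    refine hno s hs ((c (toReal s) : ℝ)⁻¹ * b) (by positivity) ?_
    rw [mul_smul, hb', smul_smul, inv_mul_cancel₀ hcpos.ne', one_smul]
  choose! g hgS hg using key
  refine Set.Finite.of_finite_image (f := g) (S.finite_toSet.subset ?_) ?_
  · rintro _ ⟨u, hu, rfl⟩
    exact hgS u hu
  · intro u hu w hw h
    obtain ⟨t, ht, h1⟩ := hg u hu
    obtain ⟨s, hs, h2⟩ := hg w hw
    change g u = g w at h
    rw [← h, h1] at h2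
    refine hw.1.eq_of_smul hu.1 (r := t⁻¹ * s) (by positivity) ?_
    rw [mul_smul, ← h2, smul_smul, inv_mul_cancel₀ ht.ne', one_smul]

noncomputable instance : Fintype σ.rays := σ.rays_finite.fintype

/-! ### Conic modules -/

/-- The dual cone `σ^∨ ⊆ M_ℝ`. -/
noncomputable def dualCone : PointedCone ℝ (Fin n → ℝ) :=
  PointedCone.dual (dotProductBilin ℝ ℝ) (σ.toPointedCone : Set (Fin n → ℝ))

/-- The toric algebra `R = k[σ^∨ ∩ M]`, as a subalgebra of `k[M]`. -/
noncomputable def toricAlgebra (k : Type*) [Field k] :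
    Subalgebra k (AddMonoidAlgebra k (Fin n → ℤ)) where
  carrier := {f | ∀ m : Fin n → ℤ, f.coeff m ≠ 0 → toReal m ∈ σ.dualCone}
  mul_mem' {f g} hf hg m hm := by
    classical
    have hm' := AddMonoidAlgebra.support_coeff_mul_subset _ _ (Finsupp.mem_support_iff.2 hm)
    obtain ⟨a, ha, b, hb, rfl⟩ := Finset.mem_add.1 hm'
    have : toReal (a + b) = toReal a + toReal b := by ext i; simp [toReal]
    rw [this]
    exact Submodule.add_mem _ (hf a (Finsupp.mem_support_iff.1 ha))
      (hg b (Finsupp.mem_support_iff.1 hb))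
  add_mem' {f g} hf hg m hm := by
    by_cases h : f.coeff m = 0
    · exact hg m fun h' => hm (by simp [h, h'])
    · exact hf m h
  algebraMap_mem' r m hm := by
    have : m = 0 := by
      by_contra h
      exact hm (by simp [AddMonoidAlgebra.coe_algebraMap, Ne.symm h])
    subst this
    have h0 : toReal (0 : Fin n → ℤ) = 0 := by ext i; simp [toReal]
    rw [h0]
    exact Submodule.zero_mem _

/-- For a set `T ⊆ M` with `(σ^∨ ∩ M) + T ⊆ T`, the `R`-submodule `Span_k {x^m | m ∈ T}` of
`k[M]`, i.e. the set of Laurent polynomials all of whose monomials have exponent in `T`. -/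
noncomputable def monomialSpan (k : Type*) [Field k] (T : Set (Fin n → ℤ))
    (hT : ∀ s t : Fin n → ℤ, toReal s ∈ σ.dualCone → t ∈ T → s + t ∈ T) :
    Submodule (σ.toricAlgebra k) (AddMonoidAlgebra k (Fin n → ℤ)) where
  carrier := {f | ∀ m : Fin n → ℤ, f.coeff m ≠ 0 → m ∈ T}
  zero_mem' m hm := absurd rfl hm
  add_mem' {f g} hf hg m hm := by
    by_cases h : f.coeff m = 0
    · exact hg m fun h' => hm (by simp [h, h'])
    · exact hf m h
  smul_mem' r f hf m hm := by
    classical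
    have hm' := AddMonoidAlgebra.support_coeff_mul_subset _ _ (Finsupp.mem_support_iff.2 hm)
    obtain ⟨a, ha, b, hb, rfl⟩ := Finset.mem_add.1 hm'
    exact hT a b (r.2 a (Finsupp.mem_support_iff.1 ha)) (hf b (Finsupp.mem_support_iff.1 hb))

/-- The conic module `A_v = Span {x^m | m ∈ M ∩ (σ^∨ + v)}`. -/
noncomputable def conicModule (k : Type*) [Field k] (v : Fin n → ℝ) :
    Submodule (σ.toricAlgebra k) (AddMonoidAlgebra k (Fin n → ℤ)) :=
  σ.monomialSpan k {m | toReal m - v ∈ σ.dualCone} fun s t hs ht => by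
    have : toReal (s + t) - v = toReal s + (toReal t - v) := by
      ext i
      simp [toReal, add_sub_assoc]
    change toReal (s + t) - v ∈ σ.dualCone
    rw [this]
    exact Submodule.add_mem _ hs ht

/-- The open conic module `Å_v = Span {x^m | m ∈ M ∩ (int(σ^∨) + v)}`. -/
noncomputable def openConicModule (k : Type*) [Field k] (v : Fin n → ℝ) :
    Submodule (σ.toricAlgebra k) (AddMonoidAlgebra k (Fin n → ℤ)) :=
  σ.monomialSpan k {m | toReal m - v ∈ interior (σ.dualCone : Set (Fin n → ℝ))}
    fun s t hs ht => by
      have : toReal (s + t) - v = toReal s + (toReal t - v) := by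
        ext i
        simp [toReal, add_sub_assoc]
      change toReal (s + t) - v ∈ interior (σ.dualCone : Set (Fin n → ℝ))
      rw [this]
      refine interior_maximal (s := (σ.dualCone : Set (Fin n → ℝ))) ?_
        (isOpen_interior.add_left (s := ({toReal s} : Set (Fin n → ℝ))))
        (Set.add_mem_add (Set.mem_singleton _) ht)
      rintro _ ⟨a, rfl, b, hb, rfl⟩
      exact Submodule.add_mem _ hs (interior_subset hb)

/-! ### Chambers of constancy and the complexes `K_v` -/

/-- The chamber of constancy `Δ_v`. -/
def chamber (k : Type*) [Field k] (v : Fin n → ℝ) : Set (Fin n → ℝ) :=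
  {w | σ.conicModule k w = σ.conicModule k v}

/-- The open cell containing `x` of the CW decomposition of `M_ℝ`: two points lie in the same
open cell iff their conic modules are equal and their open conic modules are equal. -/
def cell (k : Type*) [Field k] (x : Fin n → ℝ) : Set (Fin n → ℝ) :=
  {y | σ.conicModule k y = σ.conicModule k x ∧ σ.openConicModule k y = σ.openConicModule k x}

/-- The set of open cells of codimension `l` of the chamber of constancy `Δ_v`. -/
def cellsOfCodim (k : Type*) [Field k] (v : Fin n → ℝ) (l : ℕ) : Set (Set (Fin n → ℝ)) :=
  {τ | ∃ x ∈ σ.chamber k v, τ = σ.cell k x ∧ Module.finrank ℝ (vectorSpan ℝ τ) + l = n}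

/-- The open conic module `Å_τ` of an open cell `τ`: the common value of `Å_x` for `x ∈ τ`. -/
noncomputable def cellModule (k : Type*) [Field k] (τ : Set (Fin n → ℝ)) :
    Submodule (σ.toricAlgebra k) (AddMonoidAlgebra k (Fin n → ℤ)) :=
  ⨆ x ∈ τ, σ.openConicModule k x

theorem cellModule_cell (k : Type*) [Field k] (x : Fin n → ℝ) :
    σ.cellModule k (σ.cell k x) = σ.openConicModule k x :=
  le_antisymm (iSup₂_le fun _ hy => hy.2.le)
    (le_iSup₂_of_le (f := fun y (_ : y ∈ σ.cell k x) => σ.openConicModule k y) x ⟨rfl, rfl⟩ le_rfl)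

/-- The term in degree `l` of the complex `K_v`: the direct sum of the `Å_τ` over the open cells
`τ` of codimension `l` of `Δ_v`. -/
abbrev complexTerm (k : Type*) [Field k] (v : Fin n → ℝ) (l : ℕ) : Type _ :=
  ⨁ τ : σ.cellsOfCodim k v l, σ.cellModule k τ.1

/-- The isomorphism class of `A_w` appears in `K_v` in degree `l`: the module `A_w` is isomorphic
to one of the summands `Å_τ` of the degree `l` term of `K_v`. -/
def AppearsInDegree (k : Type*) [Field k] (w v : Fin n → ℝ) (l : ℕ) : Prop :=
  ∃ τ : σ.cellsOfCodim k v l,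
    Nonempty (σ.conicModule k w ≃ₗ[σ.toricAlgebra k] σ.cellModule k τ.1)

/-- The isomorphism class of `A_w` appears in `K_v`. -/
def Appears (k : Type*) [Field k] (w v : Fin n → ℝ) : Prop :=
  ∃ l : ℕ, σ.AppearsInDegree k w v l

/-! ### Divisors, the class group over `ℝ`, and the zonotope -/

/-- `div(x^m) = ∑_ρ ⟨m, u_ρ⟩ D_ρ`. -/
def divisor (m : Fin n → ℤ) : σ.rays → ℤ := fun ρ => m ⬝ᵥ ρ.1

/-- Linear equivalence of torus-invariant Weil divisors `∑_ρ D ρ • D_ρ`. -/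
def LinEquiv (D E : σ.rays → ℤ) : Prop := ∃ m : Fin n → ℤ, D = E + σ.divisor m

/-- The divisor `-d(v) = ∑_ρ ⌊⟨-v, u_ρ⟩⌋ D_ρ`. -/
noncomputable def negD (v : Fin n → ℝ) : σ.rays → ℤ := fun ρ => ⌊(-v) ⬝ᵥ toReal ρ.1⌋

/-- The map `M_ℝ → ⨁_ρ ℝ D_ρ`, `x ↦ ∑_ρ ⟨x, u_ρ⟩ D_ρ`. -/
noncomputable def divisorReal : (Fin n → ℝ) →ₗ[ℝ] (σ.rays → ℝ) :=
  LinearMap.pi fun ρ => (dotProductBilin ℝ ℝ).flip (toReal ρ.1)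

/-- `Cl_ℝ`, the cokernel of `M_ℝ → ⨁_ρ ℝ D_ρ`. -/
abbrev ClReal : Type := (σ.rays → ℝ) ⧸ LinearMap.range σ.divisorReal

/-- The cokernel map `f_σ : ⨁_ρ ℝ D_ρ → Cl_ℝ`. -/
noncomputable def fσ : (σ.rays → ℝ) →ₗ[ℝ] σ.ClReal :=
  (LinearMap.range σ.divisorReal).mkQ

/-- The value of `f_σ` on an integral divisor. -/
noncomputable def fInt (D : σ.rays → ℤ) : σ.ClReal := σ.fσ fun ρ => (D ρ : ℝ)

/-- `β_ρ = f_σ(D_ρ)`. -/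
noncomputable def β (ρ : σ.rays) : σ.ClReal := σ.fσ (Pi.single ρ 1)

/-- The half-open zonotope, the image of `(-1, 0]^σ(1)` under `f_σ`. -/
noncomputable def zonotope : Set σ.ClReal := σ.fσ '' {a | ∀ ρ, a ρ ∈ Set.Ioc (-1 : ℝ) 0}

/-- The lattice points of the zonotope, with respect to the lattice `f_σ(ℤ^σ(1))`. -/
noncomputable def latticePoints : Set σ.ClReal := σ.zonotope ∩ Set.range σ.fInt

/-! ### Paths -/

/-- The subset `J ⊆ σ(1)` gives a path `β_J` from `P₁` to `P₂`. -/
def IsPath (J : Finset σ.rays) (P₁ P₂ : σ.ClReal) : Prop :=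
  P₁ ∈ σ.latticePoints ∧ P₂ ∈ σ.latticePoints ∧ P₁ + ∑ ρ ∈ J, σ.β ρ = P₂

/-- The length `rk(A_J)` of the path `β_J`; `A_J` is the matrix with rows `u_ρ`, `ρ ∈ J`. -/
noncomputable def pathLength (J : Finset σ.rays) : ℕ :=
  (Matrix.of fun (ρ : J) (i : Fin n) => (ρ.1.1 i : ℝ)).rank

/-- The interval `{γ β_ρ | γ ∈ (-α_ρ - 1, -α_ρ)}`. -/
noncomputable def interval (α : σ.rays → ℚ) (ρ : σ.rays) : Set σ.ClReal :=
  (fun γ : ℝ => γ • σ.β ρ) '' Set.Ioo (-(α ρ : ℝ) - 1) (-(α ρ : ℝ))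

/-- The condition `∑_{ρ ∈ J} α_ρ β_ρ ∈ ∑_{ρ ∉ J} {γ β_ρ | γ ∈ (-α_ρ - 1, -α_ρ)}` on `J` and `α`;
the right hand side is a Minkowski sum of sets, which is `{0}` if `J = σ(1)`. -/
def ValidityCondition (J : Finset σ.rays) (α : σ.rays → ℚ) : Prop :=
  ∑ ρ ∈ J, (α ρ : ℝ) • σ.β ρ ∈ ∑ ρ ∈ Jᶜ, σ.interval α ρ

/-- The path `β_J` from `P₁` to `P₂` is valid: the validity condition holds when `P₂` is written
as `∑_ρ α_ρ β_ρ` with rational `α_ρ`. -/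
def IsValidPath (J : Finset σ.rays) (P₁ P₂ : σ.ClReal) : Prop :=
  σ.IsPath J P₁ P₂ ∧
    ∃ α : σ.rays → ℚ, P₂ = ∑ ρ, (α ρ : ℝ) • σ.β ρ ∧ σ.ValidityCondition J α

theorem validityCondition_iff (J : Finset σ.rays) (α : σ.rays → ℚ) :
    σ.ValidityCondition J α ↔ ∃ t : σ.rays → ℝ, (∀ ρ, t ρ ∈ Set.Ioo (0 : ℝ) 1) ∧
      ∑ ρ, (α ρ : ℝ) • σ.β ρ = -∑ ρ ∈ Jᶜ, t ρ • σ.β ρ := by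
  have hsplit := Finset.sum_add_sum_compl J fun ρ => (α ρ : ℝ) • σ.β ρ
  rw [ValidityCondition, Set.mem_finsetSum]
  constructor
  · rintro ⟨g, hg, hsum⟩
    have h : ∀ ρ, ∃ t : ℝ, t ∈ Set.Ioo (0 : ℝ) 1 ∧
        (ρ ∈ Jᶜ → g ρ = (-(α ρ : ℝ) - t) • σ.β ρ) := fun ρ => by
      by_cases hρ : ρ ∈ Jᶜ
      · obtain ⟨γ, hγ, h⟩ := hg hρ
        exact ⟨-(α ρ : ℝ) - γ, ⟨by linarith [hγ.2], by linarith [hγ.1]⟩,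
          fun _ => by rw [← h]; simp⟩
      · exact ⟨1 / 2, by norm_num, fun h => absurd h hρ⟩
    choose t ht hgt using h
    refine ⟨t, ht, ?_⟩
    rw [← hsplit, ← hsum, Finset.sum_congr rfl hgt]
    simp only [sub_smul, neg_smul, Finset.sum_sub_distrib, Finset.sum_neg_distrib]
    abel
  · rintro ⟨t, ht, hsum⟩
    refine ⟨fun ρ => (-(α ρ : ℝ) - t ρ) • σ.β ρ, fun {ρ} _ => ⟨_, ⟨?_, ?_⟩, rfl⟩, ?_⟩
    · linarith [(ht ρ).2]
    · linarith [(ht ρ).1]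
    · rw [← hsplit] at hsum
      simp only [sub_smul, neg_smul, Finset.sum_sub_distrib, Finset.sum_neg_distrib]
      rw [eq_sub_of_add_eq hsum]
      abel

/-- The validity of a path does not depend on the choice of the coefficients `α_ρ`. -/
theorem validityCondition_congr (J : Finset σ.rays) {α α' : σ.rays → ℚ}
    (h : ∑ ρ, (α ρ : ℝ) • σ.β ρ = ∑ ρ, (α' ρ : ℝ) • σ.β ρ) :
    σ.ValidityCondition J α ↔ σ.ValidityCondition J α' := by
  rw [validityCondition_iff, validityCondition_iff, h]

/-- The divisor `∑_{ρ ∈ J} D_ρ`. -/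
def sumD (J : Finset σ.rays) : σ.rays → ℤ := ∑ ρ ∈ J, Pi.single ρ 1

end ToricCone

/-! ### Rays of the cone and facets of its dual -/

namespace ToricCone

/-! Both sides of the correspondence are encoded by the same combinatorial data of a point `x` of
`M_ℝ`: the divisor `D = -d(x)` and the set `J` of rays `ρ` on which `⟨x, u_ρ⟩` is an integer
(`integralRays`).

Module side. `A_x` is spanned by the monomials `x^m` with `⟨m, u_ρ⟩ ≥ -D_ρ`, and `Å_x` by those
satisfying the same bounds raised by one exactly on `J`. Each ray defines a facet of the dual cone
(`exists_facet`), so every such bound is attained at a lattice point (`exists_divisor_eq`). Hence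
the module determines its bounds, and an open cell is precisely a level set of `(D, J)`. The cell is
open in an affine space with direction the kernel of `A_J`, so its codimension is `rk(A_J)`.
Homomorphisms between these modules are multiplications by Laurent polynomials, and units of `k[M]`
are monomials, so isomorphism amounts to linear equivalence (`nonempty_linearEquiv_iff`). Thus `A_w`
appears in degree `l` iff some `x ∈ Δ_v` with set `J` has `l = rk(A_J)` and `-d(w) ∼ -d(v) - ∑_{ρ ∈
J} D_ρ` (`appearsInDegree_iff`).

Path side. The kernel of `f_σ` is the image of `M_ℝ`, so validity of `β_J` with endpoint
`f_σ(-d(v))` unwinds to the existence of `x ∈ Δ_v` with set `J` (`isValidPath_iff`). An integral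
divisor has its class in `Z` iff it equals some `-d(w)` (`fInt_mem_zonotope_iff`), which produces
`w` from the starting point of a path. -/

theorem toReal_dotProduct {n : ℕ} (a b : Fin n → ℤ) :
    toReal a ⬝ᵥ toReal b = ((a ⬝ᵥ b : ℤ) : ℝ) := by
  simp [toReal, dotProduct]

theorem toReal_ne_zero {n : ℕ} {u : Fin n → ℤ} (hu : u ≠ 0) : toReal u ≠ 0 := by
  intro h
  apply hu
  ext i
  simpa [toReal] using congrFun h i

theorem IsPrimitive.ne_zero {n : ℕ} {u : Fin n → ℤ} (hu : IsPrimitive u) : u ≠ 0 := by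
  rintro rfl
  simpa using hu 0 0 (by simp)

/-- A nonzero lattice vector is a positive multiple of a primitive one. -/
theorem exists_isPrimitive {n : ℕ} {s : Fin n → ℤ} (hs : s ≠ 0) :
    ∃ u, IsPrimitive u ∧ ∃ r : ℝ, 0 < r ∧ toReal s = r • toReal u := by
  obtain ⟨i, hi⟩ := Function.ne_iff.1 hs
  obtain ⟨u, hu, hu1⟩ := Finset.extract_gcd s ⟨i, Finset.mem_univ i⟩
  have hd : 0 < Finset.univ.gcd s := by
    refine lt_of_le_of_ne (Int.nonneg_of_normalize_eq_self Finset.normalize_gcd) fun h => hi ?_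
    rw [hu i (Finset.mem_univ i), ← h, zero_mul, Pi.zero_apply]
  refine ⟨u, fun d w hw => ?_, (Finset.univ.gcd s : ℤ), by exact_mod_cast hd, ?_⟩
  · rw [isUnit_iff_dvd_one, ← hu1]
    exact Finset.dvd_gcd fun j _ => ⟨w j, by simp [hw]⟩
  · ext j
    simp only [toReal, Pi.smul_apply, smul_eq_mul]
    exact_mod_cast hu j (Finset.mem_univ j)

/-- A primitive vector takes the value one on some vector of the dual lattice. -/
theorem IsPrimitive.exists_dotProduct_eq_one {n : ℕ} {u : Fin n → ℤ} (hu : IsPrimitive u) :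
    ∃ c : Fin n → ℤ, c ⬝ᵥ u = 1 := by
  obtain ⟨d, hd⟩ := (inferInstance : (Ideal.span (Set.range u)).IsPrincipal)
  have hdvd : ∀ i, d ∣ u i := fun i => by
    rw [← Ideal.mem_span_singleton]
    have : u i ∈ Ideal.span (Set.range u) := Ideal.subset_span ⟨i, rfl⟩
    rw [hd] at this
    exact this
  choose c hc using hdvd
  have hunit : IsUnit d := hu d c (by ext i; simp [hc i])
  have h1 : (1 : ℤ) ∈ Ideal.span (Set.range u) := by
    rw [hd]
    exact (Ideal.span_singleton_eq_top.2 hunit).ge trivial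
  rw [Ideal.mem_span_range_iff_exists_fun] at h1
  exact h1

variable {n : ℕ} (σ : ToricCone n)

theorem smul_mem {x : Fin n → ℝ} (hx : x ∈ σ.toPointedCone) {r : ℝ} (hr : 0 ≤ r) :
    r • x ∈ σ.toPointedCone :=
  Submodule.smul_mem _ (⟨r, hr⟩ : {c : ℝ // 0 ≤ c}) hx

/-- In a strongly convex cone a sum of elements vanishes only if all of them vanish. -/
theorem eq_zero_of_sum_eq_zero {ι : Type*} {s : Finset ι} {z : ι → Fin n → ℝ}
    (hz : ∀ i ∈ s, z i ∈ σ.toPointedCone) (h : ∑ i ∈ s, z i = 0) : ∀ i ∈ s, z i = 0 := by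
  classical
  intro i hi
  by_contra hne
  refine σ.salient (z i) (hz i hi) hne ?_
  have h' := Finset.add_sum_erase s z hi
  rw [h] at h'
  rw [neg_eq_of_add_eq_zero_right h']
  exact Submodule.sum_mem _ fun j hj => hz j (Finset.mem_of_mem_erase hj)

theorem mem_hull_finset {S : Finset (Fin n → ℤ)} {x : Fin n → ℝ} :
    x ∈ PointedCone.hull ℝ (toReal '' (S : Set (Fin n → ℤ))) ↔
      ∃ c : (Fin n → ℤ) → ℝ, (∀ t, 0 ≤ c t) ∧ ∑ t ∈ S, c t • toReal t = x := by
  constructor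
  · intro hx
    induction hx using Submodule.span_induction with
    | mem x h =>
      classical
      obtain ⟨t, ht, rfl⟩ := h
      refine ⟨Pi.single t 1, fun s => ?_, ?_⟩
      · by_cases h : s = t
        · subst h; simp
        · simp [h]
      · rw [Finset.sum_eq_single_of_mem t ht fun s _ hs => by simp [hs]]
        simp
    | zero => exact ⟨0, fun _ => le_rfl, by simp⟩
    | add x y _ _ hx hy =>
      obtain ⟨c, hc, rfl⟩ := hx
      obtain ⟨d, hd, rfl⟩ := hy
      exact ⟨c + d, fun t => add_nonneg (hc t) (hd t), by
        simp [add_smul, Finset.sum_add_distrib]⟩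
    | smul a x _ hx =>
      obtain ⟨c, hc, rfl⟩ := hx
      exact ⟨fun t => a.1 * c t, fun t => mul_nonneg a.2 (hc t), by
        rw [Finset.smul_sum]
        exact Finset.sum_congr rfl fun t _ => mul_smul _ _ _⟩
  · rintro ⟨c, hc, rfl⟩
    refine Submodule.sum_mem _ fun t ht => ?_
    exact Submodule.smul_mem _ (⟨c t, hc t⟩ : {c : ℝ // 0 ≤ c})
      (PointedCone.subset_hull ⟨t, ht, rfl⟩)

theorem hull_singleton_smul (x : Fin n → ℝ) {r : ℝ} (hr : 0 < r) :
    PointedCone.hull ℝ {r • x} = PointedCone.hull ℝ {x} := by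
  apply le_antisymm <;> rw [PointedCone.hull, Submodule.span_singleton_le_iff_mem,
    PointedCone.hull, Submodule.mem_span_singleton]
  · exact ⟨⟨r, hr.le⟩, rfl⟩
  · refine ⟨⟨r⁻¹, inv_nonneg.2 hr.le⟩, ?_⟩
    change r⁻¹ • r • x = x
    rw [smul_smul, inv_mul_cancel₀ hr.ne', one_smul]

theorem hull_erase_eq [DecidableEq (Fin n → ℤ)] {S : Finset (Fin n → ℤ)} {s : Fin n → ℤ}
    (h : toReal s ∈ PointedCone.hull ℝ (toReal '' (S.erase s : Set (Fin n → ℤ)))) :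
    PointedCone.hull ℝ (toReal '' (S : Set (Fin n → ℤ))) =
      PointedCone.hull ℝ (toReal '' (S.erase s : Set (Fin n → ℤ))) := by
  apply le_antisymm
  · refine Submodule.span_le.2 ?_
    rintro _ ⟨t, ht, rfl⟩
    by_cases hts : t = s
    · rw [hts]; exact h
    · exact PointedCone.subset_hull ⟨t, by simpa [hts] using ht, rfl⟩
  · exact Submodule.span_mono (Set.image_mono (by simp))

/-- A strongly convex rational polyhedral cone is generated by its rays. -/
theorem hull_rays : PointedCone.hull ℝ (toReal '' σ.rays) = σ.toPointedCone := by
  classical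
  apply le_antisymm
  · refine Submodule.span_le.2 ?_
    rintro _ ⟨u, hu, rfl⟩
    exact hu.2.le (PointedCone.subset_hull rfl)
  -- In a minimal finite generating set no generator is redundant; each one is shown to span a ray.
  obtain ⟨S, hS, hmin⟩ := exists_minimal_of_wellFoundedLT
    (fun S : Finset (Fin n → ℤ) =>
      σ.toPointedCone = PointedCone.hull ℝ (toReal '' (S : Set (Fin n → ℤ)))) σ.rational
  have hnot : ∀ s ∈ S,
      toReal s ∉ PointedCone.hull ℝ (toReal '' (S.erase s : Set (Fin n → ℤ))) := by
    intro s hs h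
    have := hmin (hS.trans (hull_erase_eq h)) (Finset.erase_subset s S) hs
    simp at this
  have hmem : ∀ s ∈ S, toReal s ∈ σ.toPointedCone := fun s hs => by
    rw [hS]; exact PointedCone.subset_hull ⟨s, hs, rfl⟩
  conv_lhs => rw [hS]
  refine Submodule.span_le.2 ?_
  rintro _ ⟨s, hs, rfl⟩
  have hs0 : s ≠ 0 := by
    rintro rfl
    refine hnot 0 hs ?_
    have : toReal (0 : Fin n → ℤ) = 0 := by ext i; simp [toReal]
    rw [this]
    exact Submodule.zero_mem _
  obtain ⟨u, hu, r, hr, hsu⟩ := exists_isPrimitive hs0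
  have hface : (PointedCone.hull ℝ {toReal s}).IsFaceOf σ.toPointedCone := by
    refine ⟨?_, ?_⟩
    · rw [PointedCone.hull, Submodule.span_singleton_le_iff_mem]
      exact hmem s hs
    · intro x y a hx hy ha hxy
      rw [hS, mem_hull_finset] at hx hy
      obtain ⟨c, hc, rfl⟩ := hx
      obtain ⟨d, hd, rfl⟩ := hy
      rw [PointedCone.hull, Submodule.mem_span_singleton] at hxy ⊢
      obtain ⟨b, hb⟩ := hxy
      change b.1 • toReal s = _ at hb
      have hb' : ∑ t ∈ S, (a * c t + d t) • toReal t = b.1 • toReal s := by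
        rw [hb, Finset.smul_sum, ← Finset.sum_add_distrib]
        exact Finset.sum_congr rfl fun t _ => by rw [add_smul, mul_smul]
      have he : ∀ t, 0 ≤ a * c t + d t := fun t =>
        add_nonneg (mul_nonneg ha.le (hc t)) (hd t)
      rw [← Finset.add_sum_erase S _ hs] at hb'
      -- Otherwise solving the relation for `toReal s` would express it through the other
      -- generators.
      have hle : b.1 ≤ a * c s + d s := by
        by_contra! hlt
        refine hnot s hs (mem_hull_finset.2
          ⟨fun t => (b.1 - (a * c s + d s))⁻¹ * (a * c t + d t),
            fun t => mul_nonneg (inv_nonneg.2 (by linarith)) (he t), ?_⟩)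
        simp only [mul_smul, ← Finset.smul_sum]
        rw [eq_sub_of_add_eq' hb', ← sub_smul, smul_smul, inv_mul_cancel₀ (by linarith), one_smul]
      -- Moving `b • s` to the left leaves a vanishing nonnegative combination, so by strong
      -- convexity each of its terms vanishes.
      have hzero : ∀ t ∈ S.erase s, c t • toReal t = 0 := by
        intro t ht
        have h0 : ∑ t ∈ S, (if t = s then a * c s + d s - b.1 else a * c t + d t) • toReal t
            = 0 := by
          rw [← Finset.add_sum_erase S _ hs, Finset.sum_congr rfl fun t ht => by
            rw [if_neg (Finset.ne_of_mem_erase ht)], if_pos rfl, eq_sub_of_add_eq' hb', sub_smul]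
          abel
        have := σ.eq_zero_of_sum_eq_zero (fun t ht => σ.smul_mem (hmem t ht) (by
          split_ifs
          · linarith
          · exact he t)) h0 t (Finset.mem_of_mem_erase ht)
        rw [if_neg (Finset.ne_of_mem_erase ht)] at this
        rcases smul_eq_zero.1 this with h | h
        · have h1 : 0 ≤ a * c t := mul_nonneg ha.le (hc t)
          have h2 : a * c t = 0 := by linarith [hd t]
          rw [(mul_eq_zero.1 h2).resolve_left ha.ne', zero_smul]
        · rw [h, smul_zero]
      refine ⟨⟨c s, hc s⟩, ?_⟩
      rw [← Finset.add_sum_erase S _ hs, Finset.sum_eq_zero hzero, add_zero]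
      rfl
  rw [hsu, hull_singleton_smul _ hr] at hface
  rw [hsu]
  exact Submodule.smul_mem _ (⟨r, hr.le⟩ : {c : ℝ // 0 ≤ c})
    (PointedCone.subset_hull ⟨u, ⟨hu, hface⟩, rfl⟩)

/-- Nonnegativity need only be tested on generators, and the rays generate `σ` by `hull_rays`. -/
theorem mem_dualCone {y : Fin n → ℝ} :
    y ∈ σ.dualCone ↔ ∀ ρ : σ.rays, 0 ≤ y ⬝ᵥ toReal ρ.1 := by
  rw [dualCone, ← σ.hull_rays, PointedCone.dual_hull, PointedCone.mem_dual]
  simp [dotProduct_comm]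

theorem mem_interior_dualCone {y : Fin n → ℝ} :
    y ∈ interior (σ.dualCone : Set (Fin n → ℝ)) ↔ ∀ ρ : σ.rays, 0 < y ⬝ᵥ toReal ρ.1 := by
  constructor
  · intro hy ρ
    -- From an interior point one can move slightly in direction `-u_ρ` within the dual cone. This
    -- lowers the pairing with `u_ρ` by `ε ⟨u_ρ, u_ρ⟩ > 0`, so the pairing was strictly positive.
    have hcont : Filter.Tendsto (fun ε : ℝ => y - ε • toReal ρ.1)
        (nhdsWithin 0 (Set.Ioi 0)) (nhds y) := by
      have : Continuous fun ε : ℝ => y - ε • toReal ρ.1 := by fun_prop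
      simpa using (this.tendsto 0).mono_left nhdsWithin_le_nhds
    obtain ⟨ε, h, hε⟩ :=
      ((hcont.eventually (mem_interior_iff_mem_nhds.1 hy)).and self_mem_nhdsWithin).exists
    have h1 := σ.mem_dualCone.1 h ρ
    have hpos : 0 < toReal ρ.1 ⬝ᵥ toReal ρ.1 :=
      lt_of_le_of_ne (Finset.sum_nonneg fun i _ => mul_self_nonneg _) fun h0 =>
        toReal_ne_zero ρ.2.1.ne_zero (dotProduct_self_eq_zero.1 h0.symm)
    rw [sub_dotProduct, smul_dotProduct, smul_eq_mul] at h1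
    have := mul_pos (Set.mem_Ioi.1 hε) hpos
    linarith
  · intro hy
    refine mem_interior.2 ⟨{x | ∀ ρ : σ.rays, 0 < x ⬝ᵥ toReal ρ.1}, fun x hx => ?_, ?_, hy⟩
    · exact σ.mem_dualCone.2 fun ρ => (hx ρ).le
    · rw [Set.ofPred_forall]
      exact isOpen_iInter_of_finite fun ρ => isOpen_lt continuous_const (by
        unfold dotProduct; fun_prop)

theorem toReal_ray_mem (ρ : σ.rays) : toReal ρ.1 ∈ σ.toPointedCone :=
  ρ.2.2.le (PointedCone.subset_hull rfl)

/-- The coefficients of the other rays vanish in a relation expressing a point of the line spanned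
by a ray. -/
theorem eq_zero_of_sum_eq_smul (ρ : σ.rays) (w : σ.rays → ℝ) (hw : ∀ τ, 0 ≤ w τ)
    {s : Finset σ.rays} {r : ℝ} (h : ∑ τ ∈ s, w τ • toReal τ.1 = r • toReal ρ.1) :
    ∀ τ ∈ s, τ ≠ ρ → w τ = 0 := by
  classical
  intro τ hτ hne
  have hmem : ∀ τ : σ.rays, w τ • toReal τ.1 ∈ σ.toPointedCone := fun τ =>
    σ.smul_mem (σ.toReal_ray_mem τ) (hw τ)
  by_contra hwτ
  have hpos : 0 < w τ := lt_of_le_of_ne (hw τ) (Ne.symm hwτ)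
  rw [← Finset.add_sum_erase s _ hτ] at h
  have hrest : ∑ τ ∈ s.erase τ, w τ • toReal τ.1 ∈ σ.toPointedCone :=
    Submodule.sum_mem _ fun τ _ => hmem τ
  -- For `r ≥ 0` the face property puts `u_τ` on the ray of `ρ`, whence `τ = ρ`. For `r < 0` the
  -- relation puts `-w τ • u_τ` in `σ`, contradicting strong convexity.
  rcases le_or_gt 0 r with hr | hr
  · have hin := ρ.2.2.mem_of_smul_add_mem (σ.toReal_ray_mem τ) hrest hpos (by
      rw [h, PointedCone.hull, Submodule.mem_span_singleton]
      exact ⟨⟨r, hr⟩, rfl⟩)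
    rw [PointedCone.hull, Submodule.mem_span_singleton] at hin
    obtain ⟨b, hb⟩ := hin
    change b.1 • toReal ρ.1 = toReal τ.1 at hb
    have hb0 : b.1 ≠ 0 := by
      intro h0
      rw [h0, zero_smul] at hb
      exact toReal_ne_zero τ.2.1.ne_zero hb.symm
    exact hne (Subtype.ext (ρ.2.1.eq_of_smul τ.2.1 (lt_of_le_of_ne b.2 (Ne.symm hb0)) hb.symm))
  · have hneg := σ.salient _ (hmem τ)
      (smul_ne_zero hpos.ne' (toReal_ne_zero τ.2.1.ne_zero))
    refine hneg ?_
    have : -(w τ • toReal τ.1) = ∑ τ ∈ s.erase τ, w τ • toReal τ.1 + (-r) • toReal ρ.1 := by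
      rw [eq_sub_of_add_eq' h, neg_smul]; abel
    rw [this]
    exact Submodule.add_mem _ hrest (σ.smul_mem (σ.toReal_ray_mem ρ) (by linarith))

/-- Every ray of `σ` is cut out by a facet of the dual cone. -/
theorem exists_facet (ρ : σ.rays) : ∃ y : Fin n → ℝ, y ⬝ᵥ toReal ρ.1 = 0 ∧
    ∀ τ : σ.rays, τ ≠ ρ → 0 < y ⬝ᵥ toReal τ.1 := by
  classical
  let T : Finset σ.rays := Finset.univ.erase ρ
  let P : Set (Fin n → ℝ) := convexHull ℝ ((fun τ : σ.rays => toReal τ.1) '' T)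
  let l : Submodule ℝ (Fin n → ℝ) := Submodule.span ℝ {toReal ρ.1}
  -- The convex hull of the other generators misses the line through `u_ρ`: at a common point all
  -- convex weights would vanish, though their sum is one. A functional separating the two then
  -- gives `y`.
  have hdisj : Disjoint P (l : Set (Fin n → ℝ)) := by
    rw [Set.disjoint_left]
    intro x hx hxl
    obtain ⟨r, rfl⟩ := Submodule.mem_span_singleton.1 hxl
    have hinj : Function.Injective fun τ : σ.rays => toReal τ.1 := by
      intro a b hab
      ext i
      have h : (a.1 i : ℝ) = b.1 i := congrFun hab i
      exact_mod_cast h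
    change _ ∈ convexHull ℝ _ at hx
    rw [← Finset.coe_image, Finset.mem_convexHull'] at hx
    obtain ⟨w, hw, hw1, hsum⟩ := hx
    rw [Finset.sum_image hinj.injOn] at hw1 hsum
    have hw' : ∀ τ ∈ T, 0 ≤ w (toReal τ.1) := fun τ hτ => hw _ (Finset.mem_image_of_mem _ hτ)
    have h0 := σ.eq_zero_of_sum_eq_smul ρ (fun τ => if τ ∈ T then w (toReal τ.1) else 0)
      (fun τ => by split_ifs with h; exacts [hw' τ h, le_rfl]) (s := T) (r := r) (by
        rw [← hsum]
        exact Finset.sum_congr rfl fun τ hτ => by rw [if_pos hτ])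
    rw [Finset.sum_eq_zero fun τ hτ => by
      simpa [hτ] using h0 τ hτ (Finset.ne_of_mem_erase hτ)] at hw1
    exact zero_ne_one hw1
  obtain ⟨f, a, b, ha, hab, hb⟩ := geometric_hahn_banach_compact_closed
    (convex_convexHull ℝ _)
    (((T.finite_toSet.image (fun τ : σ.rays => toReal τ.1))).isCompact_convexHull ℝ)
    l.convex l.closed_of_finiteDimensional hdisj
  -- A functional bounded below on a line vanishes on it; the multiple chosen here would take the
  -- value `b - 1`.
  have hf0 : f (toReal ρ.1) = 0 := by
    by_contra hne
    have := hb (((b - 1) / f (toReal ρ.1)) • toReal ρ.1)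
      (Submodule.smul_mem _ _ (Submodule.mem_span_singleton_self _))
    rw [map_smul, smul_eq_mul, div_mul_cancel₀ _ hne] at this
    linarith
  have hb0 : b < 0 := by simpa using hb 0 l.zero_mem
  have hdot : ∀ x, (fun i => -f (Pi.single i 1)) ⬝ᵥ x = -f x := fun x => by
    conv_rhs => rw [pi_eq_sum_univ' x, map_sum]
    simp [dotProduct, mul_comm]
  refine ⟨fun i => -f (Pi.single i 1), by rw [hdot, hf0, neg_zero], fun τ hτ => ?_⟩
  rw [hdot]
  have := ha (toReal τ.1) (subset_convexHull ℝ _ ⟨τ, by simp [T, hτ], rfl⟩)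
  linarith

theorem divisor_add (a b : Fin n → ℤ) : σ.divisor (a + b) = σ.divisor a + σ.divisor b := by
  ext ρ
  simp [divisor, add_dotProduct]

theorem divisor_neg (a : Fin n → ℤ) : σ.divisor (-a) = -σ.divisor a := by
  ext ρ
  simp [divisor, neg_dotProduct]

/-- The bounds `c` of a polyhedron with facet normals the rays of `σ` are attained at lattice
points. -/
theorem exists_divisor_eq (c : σ.rays → ℤ) (ρ : σ.rays) :
    ∃ m : Fin n → ℤ, σ.divisor m ρ = c ρ ∧ c ≤ σ.divisor m := by
  obtain ⟨y, hy0, hy⟩ := σ.exists_facet ρ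
  obtain ⟨p, hp⟩ := ρ.2.1.exists_dotProduct_eq_one
  -- Go far out along the facet: `q N` rounds `N y` with error at most `C τ` in each pairing, and a
  -- multiple of `p` corrects the value at `ρ` to exactly `c ρ`. As `⟨y, u_ρ⟩ = 0`, this correction
  -- stays bounded in `N`, while the other pairings grow linearly.
  let q : ℕ → Fin n → ℤ := fun N i => ⌊(N : ℝ) * y i⌋
  let C : σ.rays → ℝ := fun τ => ∑ i, |toReal τ.1 i|
  have hq : ∀ N τ, |toReal (q N) ⬝ᵥ toReal τ.1 - N * (y ⬝ᵥ toReal τ.1)| ≤ C τ := by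
    intro N τ
    rw [dotProduct, dotProduct, Finset.mul_sum, ← Finset.sum_sub_distrib]
    refine (Finset.abs_sum_le_sum_abs _ _).trans (Finset.sum_le_sum fun i _ => ?_)
    rw [← mul_assoc, ← sub_mul, abs_mul]
    refine mul_le_of_le_one_left (abs_nonneg _) ?_
    rw [abs_le]
    have h1 := Int.floor_le ((N : ℝ) * y i)
    have h2 := Int.lt_floor_add_one ((N : ℝ) * y i)
    constructor <;> simp only [toReal, q] <;> linarith
  let m : ℕ → Fin n → ℤ := fun N => q N + (c ρ - q N ⬝ᵥ ρ.1) • p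
  have hm : ∀ N τ, σ.divisor (m N) τ = q N ⬝ᵥ τ.1 + (c ρ - q N ⬝ᵥ ρ.1) * (p ⬝ᵥ τ.1) :=
    fun N τ => by
      simp only [divisor, m, add_dotProduct, smul_dotProduct, smul_eq_mul]
  have hρ : ∀ N, σ.divisor (m N) ρ = c ρ := fun N => by rw [hm, hp]; ring
  have hev : ∀ τ : σ.rays, ∀ᶠ N in Filter.atTop, c τ ≤ σ.divisor (m N) τ := by
    intro τ
    by_cases hτ : τ = ρ
    · subst hτ
      exact Filter.Eventually.of_forall fun N => (hρ N).ge
    · have hlim : Filter.Tendsto (fun N : ℕ => (N : ℝ) * (y ⬝ᵥ toReal τ.1))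
          Filter.atTop Filter.atTop :=
        tendsto_natCast_atTop_atTop.atTop_mul_const (hy τ hτ)
      filter_upwards [hlim.eventually_ge_atTop
        (c τ + C τ + (|(c ρ : ℝ)| + C ρ) * |((p ⬝ᵥ τ.1 : ℤ) : ℝ)|)] with N hN
      have h1 := hq N τ
      have h2 := hq N ρ
      rw [hy0, mul_zero, sub_zero, toReal_dotProduct] at h2
      rw [toReal_dotProduct, abs_le] at h1
      have h3 : |(c ρ : ℝ) - (q N ⬝ᵥ ρ.1 : ℤ)| ≤ |(c ρ : ℝ)| + C ρ :=
        (abs_sub _ _).trans (by linarith)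
      have h4 : |((c ρ : ℝ) - (q N ⬝ᵥ ρ.1 : ℤ)) * ((p ⬝ᵥ τ.1 : ℤ) : ℝ)| ≤
          (|(c ρ : ℝ)| + C ρ) * |((p ⬝ᵥ τ.1 : ℤ) : ℝ)| := by
        rw [abs_mul]
        exact mul_le_mul_of_nonneg_right h3 (abs_nonneg _)
      have h5 := (abs_le.1 h4).1
      have : (c τ : ℝ) ≤ (σ.divisor (m N) τ : ℤ) := by
        rw [hm]
        push_cast
        linarith [h1.1]
      exact_mod_cast this
  obtain ⟨N, hN⟩ := (Filter.eventually_all.2 hev).exists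
  exact ⟨m N, hρ N, hN⟩

theorem exists_le_divisor (c : σ.rays → ℤ) : ∃ m : Fin n → ℤ, c ≤ σ.divisor m := by
  rcases isEmpty_or_nonempty σ.rays with h | ⟨⟨ρ⟩⟩
  · exact ⟨0, fun ρ => isEmptyElim ρ⟩
  · exact (σ.exists_divisor_eq c ρ).imp fun _ => And.right

end ToricCone

/-! ### Divisorial modules and their isomorphisms -/

namespace ToricCone

/-- The units of the Laurent polynomial ring are monomials. -/
theorem exists_single_of_mul_eq_one {k G : Type*} [Field k] [AddCommGroup G] [TwoUniqueSums G]
    {f g : AddMonoidAlgebra k G} (h : f * g = 1) :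
    ∃ (m : G) (r : k), r ≠ 0 ∧ f = AddMonoidAlgebra.single m r := by
  classical
  have hf : f ≠ 0 := by rintro rfl; simp at h
  have hg : g ≠ 0 := by rintro rfl; simp at h
  have hfc : 0 < f.coeff.support.card := by
    rw [Finset.card_pos, Finsupp.support_nonempty_iff]
    simpa using hf
  have hgc : 0 < g.coeff.support.card := by
    rw [Finset.card_pos, Finsupp.support_nonempty_iff]
    simpa using hg
  have hzero : ∀ p ∈ f.coeff.support ×ˢ g.coeff.support,
      UniqueAdd f.coeff.support g.coeff.support p.1 p.2 → p.1 + p.2 = 0 := by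
    intro p hp hu
    by_contra hne
    have h1 := AddMonoidAlgebra.coeff_mul_add_of_uniqueAdd hu
    rw [h, AddMonoidAlgebra.one_def, AddMonoidAlgebra.coeff_single,
      Finsupp.single_eq_of_ne hne] at h1
    rw [Finset.mem_product, Finsupp.mem_support_iff, Finsupp.mem_support_iff] at hp
    exact mul_ne_zero hp.1 hp.2 h1.symm
  have hcard : f.coeff.support.card = 1 := by
    by_contra hne
    -- A uniquely represented exponent survives in the product, so it must be `0`; two distinct
    -- unique pairs would both represent `0`.
    obtain ⟨p, hp, q, hq, hpq, hup, huq⟩ := TwoUniqueSums.uniqueAdd_of_one_lt_card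
      (A := f.coeff.support) (B := g.coeff.support)
      (lt_of_lt_of_le (by omega : 1 < f.coeff.support.card) (Nat.le_mul_of_pos_right _ hgc))
    have hsum : p.1 + p.2 = q.1 + q.2 := (hzero p hp hup).trans (hzero q hq huq).symm
    rw [Finset.mem_product] at hp
    obtain ⟨h1, h2⟩ := huq hp.1 hp.2 hsum
    exact hpq (Prod.ext h1 h2)
  obtain ⟨m, hm⟩ := Finset.card_eq_one.1 hcard
  obtain ⟨hne, hs⟩ := Finsupp.support_eq_singleton.1 hm
  exact ⟨m, f.coeff m, hne, AddMonoidAlgebra.coeff_injective hs⟩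

variable {n : ℕ} (σ : ToricCone n) (k : Type*) [Field k]

theorem toReal_mem_dualCone {m : Fin n → ℤ} : toReal m ∈ σ.dualCone ↔ 0 ≤ σ.divisor m := by
  rw [mem_dualCone, Pi.le_def]
  refine forall_congr' fun ρ => ?_
  rw [toReal_dotProduct]
  exact Int.cast_nonneg_iff

/-- The module spanned by the monomials `x^m` with `⟨m, u_ρ⟩ ≥ c ρ` for all `ρ`. -/
noncomputable def divisorialModule (c : σ.rays → ℤ) :
    Submodule (σ.toricAlgebra k) (AddMonoidAlgebra k (Fin n → ℤ)) :=
  σ.monomialSpan k {m | c ≤ σ.divisor m} fun s t hs ht => by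
    change c ≤ σ.divisor (s + t)
    rw [divisor_add]
    exact le_add_of_nonneg_of_le (σ.toReal_mem_dualCone.1 hs) ht

variable {k} in
theorem mem_divisorialModule {c : σ.rays → ℤ} {f : AddMonoidAlgebra k (Fin n → ℤ)} :
    f ∈ σ.divisorialModule k c ↔ ∀ m, f.coeff m ≠ 0 → c ≤ σ.divisor m := Iff.rfl

variable {k} in
theorem single_mem_divisorialModule {c : σ.rays → ℤ} {m : Fin n → ℤ} {r : k} (hr : r ≠ 0) :
    AddMonoidAlgebra.single m r ∈ σ.divisorialModule k c ↔ c ≤ σ.divisor m := by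
  rw [mem_divisorialModule]
  constructor
  · exact fun h => h m (by simpa using hr)
  · intro h m' hm'
    have : m' = m := by
      by_contra hne
      exact hm' (by simp [Ne.symm hne])
    rwa [this]

/-- For each `ρ`, test on a monomial of the source whose exponent attains the bound `c ρ`, supplied
by `exists_divisor_eq`. -/
theorem le_of_single_mul_mem {c c' : σ.rays → ℤ} {m : Fin n → ℤ} {r : k} (hr : r ≠ 0)
    (h : ∀ f ∈ σ.divisorialModule k c, AddMonoidAlgebra.single m r * f ∈ σ.divisorialModule k c') :
    c' ≤ c + σ.divisor m := by
  intro ρ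
  obtain ⟨t, ht, htc⟩ := σ.exists_divisor_eq c ρ
  have := h _ ((σ.single_mem_divisorialModule (one_ne_zero (α := k))).2 htc)
  rw [AddMonoidAlgebra.single_mul_single, mul_one, single_mem_divisorialModule _ hr,
    divisor_add] at this
  have h1 := this ρ
  simp only [Pi.add_apply] at h1 ⊢
  omega

theorem divisorialModule_injective : Function.Injective (σ.divisorialModule k) := by
  have key : ∀ c c' : σ.rays → ℤ, σ.divisorialModule k c ≤ σ.divisorialModule k c' → c' ≤ c := by
    intro c c' h
    have := σ.le_of_single_mul_mem k (one_ne_zero (α := k)) (m := 0) (c := c) (c' := c')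
      fun f hf => by
        rw [← AddMonoidAlgebra.one_def, one_mul]
        exact h hf
    have h0 : σ.divisor 0 = 0 := by ext ρ; simp [divisor]
    rwa [h0, add_zero] at this
  exact fun c c' h => le_antisymm (key _ _ h.ge) (key _ _ h.le)

/-- Homomorphisms of divisorial modules are multiplications by Laurent polynomials. -/
theorem exists_eq_mul {c c' : σ.rays → ℤ}
    (φ : σ.divisorialModule k c →ₗ[σ.toricAlgebra k] σ.divisorialModule k c') :
    ∃ f : AddMonoidAlgebra k (Fin n → ℤ), ∀ x : σ.divisorialModule k c,
      (φ x : AddMonoidAlgebra k (Fin n → ℤ)) = f * x := by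
  -- Here `x^a` lies in the source and `x^(b-a)` multiplies the source into `R`. Applying `φ` to
  -- `x^b · x = (x^(b-a) x) · x^a` shows that `φ` is multiplication by `x^(-a) φ(x^a)`.
  obtain ⟨a, ha⟩ := σ.exists_le_divisor c
  obtain ⟨b, hb⟩ := σ.exists_le_divisor (σ.divisor a - c)
  have hb0 : 0 ≤ σ.divisor b := (sub_nonneg.2 ha).trans hb
  let xa : σ.divisorialModule k c := ⟨.single a 1, (σ.single_mem_divisorialModule one_ne_zero).2 ha⟩
  let xb : σ.toricAlgebra k := ⟨.single b 1, fun m hm => by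
    have : m = b := by
      by_contra hne
      exact hm (by simp [Ne.symm hne])
    rw [this]
    exact σ.toReal_mem_dualCone.2 hb0⟩
  refine ⟨.single (-a) 1 * (φ xa : AddMonoidAlgebra k (Fin n → ℤ)), fun x => ?_⟩
  let y : σ.toricAlgebra k := ⟨.single (b - a) 1 * x.1, fun m hm => by
    rw [AddMonoidAlgebra.coeff_single_mul_apply, one_mul] at hm
    have h1 := (σ.mem_divisorialModule.1 x.2) _ hm
    rw [toReal_mem_dualCone]
    intro ρ
    have h1 := h1 ρ
    have h2 := hb ρ
    simp only [divisor, add_dotProduct, neg_dotProduct, sub_dotProduct, Pi.sub_apply,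
      Pi.zero_apply] at h1 h2 ⊢
    omega⟩
  have hxy : xb • x = y • xa := by
    apply Subtype.ext
    change AddMonoidAlgebra.single b 1 * x.1 =
      AddMonoidAlgebra.single (b - a) 1 * x.1 * AddMonoidAlgebra.single a 1
    rw [mul_right_comm, AddMonoidAlgebra.single_mul_single, mul_one, sub_add_cancel]
  have h := congrArg (fun z => (φ z : AddMonoidAlgebra k (Fin n → ℤ))) hxy
  simp only [map_smul] at h
  change AddMonoidAlgebra.single b 1 * (φ x).1 =
    AddMonoidAlgebra.single (b - a) 1 * x.1 * (φ xa).1 at h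
  have h' := congrArg (fun z => AddMonoidAlgebra.single (-b) (1 : k) * z) h
  simp only [← mul_assoc, AddMonoidAlgebra.single_mul_single, mul_one] at h'
  rw [neg_add_cancel, ← AddMonoidAlgebra.one_def, one_mul] at h'
  rw [h', show -b + (b - a) = -a by abel]
  ring

/-- Two divisorial modules are isomorphic iff their divisors are linearly equivalent. -/
theorem nonempty_linearEquiv_iff {c c' : σ.rays → ℤ} :
    Nonempty (σ.divisorialModule k c ≃ₗ[σ.toricAlgebra k] σ.divisorialModule k c') ↔
      ∃ m : Fin n → ℤ, c' = c + σ.divisor m := by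
  constructor
  · rintro ⟨φ⟩
    obtain ⟨f, hf⟩ := σ.exists_eq_mul k φ.toLinearMap
    obtain ⟨g, hg⟩ := σ.exists_eq_mul k φ.symm.toLinearMap
    simp only [LinearEquiv.coe_coe] at hf hg
    obtain ⟨a, ha⟩ := σ.exists_le_divisor c
    let xa : σ.divisorialModule k c :=
      ⟨.single a 1, (σ.single_mem_divisorialModule one_ne_zero).2 ha⟩
    have h1 : AddMonoidAlgebra.single a (1 : k) = g * (f * AddMonoidAlgebra.single a 1) := by
      have := hg (φ xa)
      rwa [φ.symm_apply_apply, hf] at this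
    -- Evaluating the composite of `φ` and its inverse at one monomial suffices, since monomials are
    -- invertible in `k[M]`.
    have hfg : f * g = 1 := by
      have := congrArg (fun z => z * AddMonoidAlgebra.single (-a) (1 : k)) h1
      simp only [mul_assoc, AddMonoidAlgebra.single_mul_single, mul_one, add_neg_cancel,
        ← AddMonoidAlgebra.one_def] at this
      rw [mul_comm, ← this]
    obtain ⟨m, r, hr, rfl⟩ := exists_single_of_mul_eq_one hfg
    have hg' : g = AddMonoidAlgebra.single (-m) r⁻¹ := by
      have := congrArg (fun z => AddMonoidAlgebra.single (-m) r⁻¹ * z) hfg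
      simpa [← mul_assoc, AddMonoidAlgebra.single_mul_single, hr,
        ← AddMonoidAlgebra.one_def] using this
    refine ⟨m, le_antisymm ?_ ?_⟩
    · refine σ.le_of_single_mul_mem k hr fun x hx => ?_
      rw [← hf ⟨x, hx⟩]
      exact (φ _).2
    · have := σ.le_of_single_mul_mem k (m := -m) (r := r⁻¹) (c := c') (c' := c)
        (inv_ne_zero hr) fun x hx => by
          rw [← hg', ← hg ⟨x, hx⟩]
          exact (φ.symm _).2
      rw [divisor_neg] at this
      exact le_sub_iff_add_le.1 (by rwa [sub_eq_add_neg])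
  · rintro ⟨m, rfl⟩
    have hinv : ∀ m : Fin n → ℤ, (LinearMap.mulLeft (σ.toricAlgebra k)
        (AddMonoidAlgebra.single m (1 : k))).comp (LinearMap.mulLeft (σ.toricAlgebra k)
        (AddMonoidAlgebra.single (-m) (1 : k))) = LinearMap.id := fun m => by
      ext1 x
      simp [← mul_assoc, AddMonoidAlgebra.single_mul_single, ← AddMonoidAlgebra.one_def]
    let e : AddMonoidAlgebra k (Fin n → ℤ) ≃ₗ[σ.toricAlgebra k] AddMonoidAlgebra k (Fin n → ℤ) :=
      LinearEquiv.ofLinearMap (LinearMap.mulLeft (σ.toricAlgebra k) (AddMonoidAlgebra.single m 1))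
        (LinearMap.mulLeft (σ.toricAlgebra k) (AddMonoidAlgebra.single (-m) 1)) (hinv m)
        (by simpa using hinv (-m))
    refine ⟨e.ofSubmodules _ _ ?_⟩
    have hmem : ∀ (m : Fin n → ℤ) (c : σ.rays → ℤ) (x), x ∈ σ.divisorialModule k c →
        AddMonoidAlgebra.single m (1 : k) * x ∈ σ.divisorialModule k (c + σ.divisor m) := by
      intro m c x hx t ht
      rw [AddMonoidAlgebra.coeff_single_mul_apply, one_mul] at ht
      have := hx _ ht
      change c ≤ σ.divisor (-m + t) at this
      rw [divisor_add, divisor_neg, neg_add_eq_sub] at this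
      exact le_sub_iff_add_le.1 this
    apply le_antisymm
    · rintro _ ⟨x, hx, rfl⟩
      exact hmem m c x hx
    · intro y hy
      refine ⟨AddMonoidAlgebra.single (-m) (1 : k) * y, ?_, e.apply_symm_apply y⟩
      have := hmem (-m) _ y hy
      rwa [divisor_neg, add_neg_cancel_right] at this

end ToricCone

/-! ### Conic modules and open cells through bounds and integral rays -/

namespace ToricCone

variable {n : ℕ} (σ : ToricCone n) (k : Type*) [Field k]

/-- The set of rays on which `x` takes an integral value. -/
noncomputable def integralRays (x : Fin n → ℝ) : Finset σ.rays :=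
  open Classical in Finset.univ.filter fun ρ => ∃ z : ℤ, x ⬝ᵥ toReal ρ.1 = z

theorem mem_integralRays {x : Fin n → ℝ} {ρ : σ.rays} :
    ρ ∈ σ.integralRays x ↔ ∃ z : ℤ, x ⬝ᵥ toReal ρ.1 = z := by
  simp [integralRays]

theorem sumD_apply (J : Finset σ.rays) (ρ : σ.rays) :
    σ.sumD J ρ = if ρ ∈ J then 1 else 0 := by
  simp [sumD, Finset.sum_apply, Pi.single_apply]

theorem sumD_injective : Function.Injective σ.sumD := by
  intro I J h
  ext ρ
  have := congrFun h ρ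
  rw [sumD_apply, sumD_apply] at this
  by_cases hI : ρ ∈ I <;> by_cases hJ : ρ ∈ J <;> simp_all

theorem negD_apply (v : Fin n → ℝ) (ρ : σ.rays) : σ.negD v ρ = -⌈v ⬝ᵥ toReal ρ.1⌉ := by
  rw [negD, neg_dotProduct, Int.floor_neg]

theorem conicModule_eq (v : Fin n → ℝ) :
    σ.conicModule k v = σ.divisorialModule k (-σ.negD v) := by
  have : ∀ m : Fin n → ℤ, toReal m - v ∈ σ.dualCone ↔ -σ.negD v ≤ σ.divisor m := fun m => by
    rw [mem_dualCone, Pi.le_def]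
    refine forall_congr' fun ρ => ?_
    rw [sub_dotProduct, sub_nonneg, toReal_dotProduct, Pi.neg_apply, negD_apply, neg_neg,
      Int.ceil_le, divisor]
  ext f
  exact forall_congr' fun m => imp_congr Iff.rfl (this m)

/-- Against an integer, a strict bound equals the weak bound by the ceiling, except that an integral
bound must be raised by one. -/
theorem lt_intCast_iff (x : Fin n → ℝ) (ρ : σ.rays) (z : ℤ) :
    x ⬝ᵥ toReal ρ.1 < z ↔ (-σ.negD x + σ.sumD (σ.integralRays x)) ρ ≤ z := by
  rw [Pi.add_apply, Pi.neg_apply, negD_apply, neg_neg, sumD_apply]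
  split_ifs with h
  · obtain ⟨y, hy⟩ := σ.mem_integralRays.1 h
    rw [hy, Int.ceil_intCast, Int.cast_lt]
    exact Int.lt_iff_add_one_le
  · rw [add_zero, Int.ceil_le]
    refine ⟨le_of_lt, fun hle => lt_of_le_of_ne hle fun heq => h ?_⟩
    exact σ.mem_integralRays.2 ⟨z, heq⟩

theorem openConicModule_eq (x : Fin n → ℝ) :
    σ.openConicModule k x =
      σ.divisorialModule k (-σ.negD x + σ.sumD (σ.integralRays x)) := by
  have : ∀ m : Fin n → ℤ, toReal m - x ∈ interior (σ.dualCone : Set (Fin n → ℝ)) ↔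
      -σ.negD x + σ.sumD (σ.integralRays x) ≤ σ.divisor m := fun m => by
    rw [mem_interior_dualCone, Pi.le_def]
    refine forall_congr' fun ρ => ?_
    rw [sub_dotProduct, sub_pos, toReal_dotProduct, lt_intCast_iff, divisor]
  ext f
  exact forall_congr' fun m => imp_congr Iff.rfl (this m)

theorem mem_chamber_iff {v w : Fin n → ℝ} : w ∈ σ.chamber k v ↔ σ.negD w = σ.negD v := by
  change σ.conicModule k w = σ.conicModule k v ↔ _
  rw [conicModule_eq, conicModule_eq, (σ.divisorialModule_injective k).eq_iff, neg_inj]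

theorem mem_cell_iff {x y : Fin n → ℝ} : y ∈ σ.cell k x ↔
    σ.negD y = σ.negD x ∧ σ.integralRays y = σ.integralRays x := by
  change σ.conicModule k y = σ.conicModule k x ∧
    σ.openConicModule k y = σ.openConicModule k x ↔ _
  rw [conicModule_eq, conicModule_eq, (σ.divisorialModule_injective k).eq_iff, neg_inj,
    openConicModule_eq, openConicModule_eq, (σ.divisorialModule_injective k).eq_iff]
  refine and_congr_right fun h => ?_
  rw [h, add_right_inj, σ.sumD_injective.eq_iff]

/-- The class of a point is determined by the bounds `⌈⟨x, u_ρ⟩⌉` and the rays on which they are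
attained. -/
theorem negD_eq_and_integralRays_eq_iff {x : Fin n → ℝ} {D : σ.rays → ℤ} {J : Finset σ.rays} :
    σ.negD x = D ∧ σ.integralRays x = J ↔
      (∀ ρ ∈ J, x ⬝ᵥ toReal ρ.1 = -D ρ) ∧
        ∀ ρ ∉ J, x ⬝ᵥ toReal ρ.1 ∈ Set.Ioo (-D ρ - 1 : ℝ) (-D ρ) := by
  constructor
  · rintro ⟨rfl, rfl⟩
    refine ⟨fun ρ hρ => ?_, fun ρ hρ => ⟨?_, lt_of_le_of_ne ?_ fun h => hρ ?_⟩⟩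
    · obtain ⟨z, hz⟩ := σ.mem_integralRays.1 hρ
      rw [negD_apply, hz]
      simp
    · rw [negD_apply]
      push_cast
      linarith [Int.ceil_lt_add_one (x ⬝ᵥ toReal ρ.1)]
    · rw [negD_apply]
      push_cast
      linarith [Int.le_ceil (x ⬝ᵥ toReal ρ.1)]
    · exact σ.mem_integralRays.2 ⟨-σ.negD x ρ, by rw [h]; push_cast; rfl⟩
  · rintro ⟨h1, h2⟩
    have hceil : ∀ ρ, ⌈x ⬝ᵥ toReal ρ.1⌉ = -D ρ := fun ρ => by
      rw [Int.ceil_eq_iff]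
      push_cast
      by_cases hρ : ρ ∈ J
      · rw [h1 ρ hρ]
        constructor <;> linarith
      · exact ⟨(h2 ρ hρ).1, (h2 ρ hρ).2.le⟩
    refine ⟨funext fun ρ => by rw [negD_apply, hceil, neg_neg], Finset.ext fun ρ => ?_⟩
    rw [mem_integralRays]
    constructor
    · rintro ⟨z, hz⟩
      by_contra hρ
      have := h2 ρ hρ
      rw [hz] at this
      have ha : -D ρ - 1 < z := by exact_mod_cast this.1
      have hb : z < -D ρ := by exact_mod_cast this.2
      omega
    · exact fun hρ => ⟨-D ρ, by rw [h1 ρ hρ]; push_cast; rfl⟩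

/-- The matrix with rows `u_ρ`, `ρ ∈ J`. -/
noncomputable def rayMatrix (J : Finset σ.rays) : Matrix J (Fin n) ℝ :=
  Matrix.of fun (ρ : J) (i : Fin n) => (ρ.1.1 i : ℝ)

theorem mem_ker_rayMatrix {J : Finset σ.rays} {x : Fin n → ℝ} :
    x ∈ LinearMap.ker (σ.rayMatrix J).mulVecLin ↔ ∀ ρ ∈ J, x ⬝ᵥ toReal ρ.1 = 0 := by
  rw [LinearMap.mem_ker, Matrix.mulVecLin_apply, funext_iff, Subtype.forall]
  refine forall₂_congr fun ρ hρ => ?_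
  rw [dotProduct_comm]
  rfl

/-- The cell is given by equations on the integral rays and open conditions on the others, so small
moves from `x` along the kernel of `A_J` remain in it. -/
theorem vectorSpan_cell (x : Fin n → ℝ) : vectorSpan ℝ (σ.cell k x) =
    LinearMap.ker (σ.rayMatrix (σ.integralRays x)).mulVecLin := by
  have hx := σ.negD_eq_and_integralRays_eq_iff.1 (⟨rfl, rfl⟩ : σ.negD x = _ ∧ _ = _)
  apply le_antisymm
  · rw [vectorSpan_def, Submodule.span_le]
    rintro _ ⟨y, hy, z, hz, rfl⟩
    rw [mem_cell_iff, negD_eq_and_integralRays_eq_iff] at hy hz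
    rw [SetLike.mem_coe, mem_ker_rayMatrix]
    intro ρ hρ
    change (y - z) ⬝ᵥ _ = 0
    rw [sub_dotProduct, hy.1 ρ hρ, hz.1 ρ hρ, sub_self]
  · intro w hw
    rw [mem_ker_rayMatrix] at hw
    have hcont : ∀ ρ : σ.rays, Filter.Tendsto (fun ε : ℝ => (x + ε • w) ⬝ᵥ toReal ρ.1)
        (nhdsWithin 0 (Set.Ioi 0)) (nhds (x ⬝ᵥ toReal ρ.1)) := fun ρ => by
      have : Continuous fun ε : ℝ => (x + ε • w) ⬝ᵥ toReal ρ.1 := by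
        unfold dotProduct
        fun_prop
      simpa using (this.tendsto 0).mono_left nhdsWithin_le_nhds
    have hev : ∀ᶠ ε in nhdsWithin (0 : ℝ) (Set.Ioi 0), ∀ ρ : σ.rays, ρ ∉ σ.integralRays x →
        (x + ε • w) ⬝ᵥ toReal ρ.1 ∈ Set.Ioo (-σ.negD x ρ - 1 : ℝ) (-σ.negD x ρ) := by
      refine Filter.eventually_all.2 fun ρ => ?_
      by_cases hρ : ρ ∈ σ.integralRays x
      · exact Filter.Eventually.of_forall fun ε h => absurd hρ h
      · exact ((hcont ρ).eventually (isOpen_Ioo.mem_nhds (hx.2 ρ hρ))).mono fun ε h _ => h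
    obtain ⟨ε, h, hε⟩ := (hev.and self_mem_nhdsWithin).exists
    have hmem : x + ε • w ∈ σ.cell k x := by
      rw [mem_cell_iff, negD_eq_and_integralRays_eq_iff]
      refine ⟨fun ρ hρ => ?_, h⟩
      rw [add_dotProduct, smul_dotProduct, hw ρ hρ, smul_zero, add_zero, hx.1 ρ hρ]
    have hv := vsub_mem_vectorSpan ℝ hmem (show x ∈ σ.cell k x from ⟨rfl, rfl⟩)
    rw [vsub_eq_sub, add_sub_cancel_left] at hv
    exact (Submodule.smul_mem_iff _ (Set.mem_Ioi.1 hε).ne').1 hv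

theorem finrank_vectorSpan_cell (x : Fin n → ℝ) :
    Module.finrank ℝ (vectorSpan ℝ (σ.cell k x)) + σ.pathLength (σ.integralRays x) = n := by
  rw [vectorSpan_cell, add_comm]
  exact (LinearMap.finrank_range_add_finrank_ker _).trans (Module.finrank_fin_fun ℝ)

/-- The module side of the dictionary: cells of `Δ_v` are replaced by points `x`, isomorphism by
linear equivalence, and codimension by `rk(A_J)` through rank–nullity. -/
theorem appearsInDegree_iff {w v : Fin n → ℝ} {l : ℕ} : σ.AppearsInDegree k w v l ↔
    ∃ x : Fin n → ℝ, σ.negD x = σ.negD v ∧ l = σ.pathLength (σ.integralRays x) ∧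
      σ.LinEquiv (σ.negD w) (σ.negD v - σ.sumD (σ.integralRays x)) := by
  have hiso : ∀ x : Fin n → ℝ, σ.negD x = σ.negD v →
      (Nonempty (σ.conicModule k w ≃ₗ[σ.toricAlgebra k] σ.cellModule k (σ.cell k x)) ↔
        σ.LinEquiv (σ.negD w) (σ.negD v - σ.sumD (σ.integralRays x))) := by
    intro x hx
    rw [cellModule_cell, conicModule_eq, openConicModule_eq, nonempty_linearEquiv_iff, hx]
    refine exists_congr fun m => ?_
    constructor <;> intro h <;> ext ρ <;> have := congrFun h ρ <;>
      simp only [Pi.add_apply, Pi.sub_apply, Pi.neg_apply] at this ⊢ <;> omega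
  constructor
  · rintro ⟨⟨_, x, hx, rfl, hl⟩, h⟩
    rw [mem_chamber_iff] at hx
    have := σ.finrank_vectorSpan_cell k x
    exact ⟨x, hx, by omega, (hiso x hx).1 h⟩
  · rintro ⟨x, hx, rfl, h⟩
    exact ⟨⟨_, x, (σ.mem_chamber_iff k).2 hx, rfl, σ.finrank_vectorSpan_cell k x⟩, (hiso x hx).2 h⟩

end ToricCone

/-! ### Lattice points of the zonotope and valid paths -/

namespace ToricCone

variable {n : ℕ} (σ : ToricCone n)

theorem divisorReal_apply (y : Fin n → ℝ) (ρ : σ.rays) :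
    σ.divisorReal y ρ = y ⬝ᵥ toReal ρ.1 := rfl

theorem fσ_eq_iff {a b : σ.rays → ℝ} : σ.fσ a = σ.fσ b ↔ ∃ y, a = b + σ.divisorReal y := by
  rw [fσ, Submodule.mkQ_apply, Submodule.mkQ_apply, Submodule.Quotient.eq, LinearMap.mem_range]
  exact exists_congr fun y => ⟨fun h => by rw [h]; abel, fun h => by rw [h]; abel⟩

theorem fσ_eq_sum (a : σ.rays → ℝ) : σ.fσ a = ∑ ρ, a ρ • σ.β ρ := by
  conv_lhs => rw [pi_eq_sum_univ' a, map_sum]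
  refine Finset.sum_congr rfl fun ρ _ => ?_
  rw [map_smul, β]

theorem fInt_add (D E : σ.rays → ℤ) : σ.fInt (D + E) = σ.fInt D + σ.fInt E := by
  rw [fInt, fInt, fInt, ← map_add]
  congr 1
  ext ρ
  simp

theorem fInt_sub (D E : σ.rays → ℤ) : σ.fInt (D - E) = σ.fInt D - σ.fInt E := by
  rw [eq_sub_iff_add_eq, ← fInt_add, sub_add_cancel]

theorem fInt_sumD (J : Finset σ.rays) : σ.fInt (σ.sumD J) = ∑ ρ ∈ J, σ.β ρ := by
  rw [fInt, fσ_eq_sum]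
  simp [sumD_apply]

theorem LinEquiv.fInt_eq {D E : σ.rays → ℤ} (h : σ.LinEquiv D E) : σ.fInt D = σ.fInt E := by
  obtain ⟨m, rfl⟩ := h
  refine σ.fσ_eq_iff.2 ⟨toReal m, ?_⟩
  ext ρ
  simp [divisorReal_apply, toReal_dotProduct, divisor]

/-- The class of an integral divisor lies in the half-open zonotope iff the divisor is `-d(w)` for
some `w`. -/
theorem fInt_mem_zonotope_iff {D : σ.rays → ℤ} :
    σ.fInt D ∈ σ.zonotope ↔ ∃ w, σ.negD w = D := by
  constructor
  · rintro ⟨a, ha, h⟩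
    obtain ⟨y, rfl⟩ := σ.fσ_eq_iff.1 h
    refine ⟨y, funext fun ρ => ?_⟩
    have := ha ρ
    rw [Pi.add_apply, divisorReal_apply, Set.mem_Ioc] at this
    rw [negD_apply, neg_eq_iff_eq_neg, Int.ceil_eq_iff]
    push_cast
    constructor <;> linarith [this.1, this.2]
  · rintro ⟨w, rfl⟩
    -- These coefficients are `⟨w, u_ρ⟩ - ⌈⟨w, u_ρ⟩⌉`, which lie in `(-1, 0]`.
    refine ⟨fun ρ => σ.negD w ρ + w ⬝ᵥ toReal ρ.1, fun ρ => ?_, σ.fσ_eq_iff.2 ⟨w, rfl⟩⟩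
    beta_reduce
    rw [negD_apply]
    push_cast
    constructor
    · linarith [Int.ceil_lt_add_one (w ⬝ᵥ toReal ρ.1)]
    · linarith [Int.le_ceil (w ⬝ᵥ toReal ρ.1)]

theorem fInt_negD_mem_latticePoints (w : Fin n → ℝ) :
    σ.fInt (σ.negD w) ∈ σ.latticePoints :=
  ⟨σ.fInt_mem_zonotope_iff.2 ⟨w, rfl⟩, ⟨_, rfl⟩⟩

/-- Validity says that `D` and `-∑_{ρ ∉ J} t_ρ D_ρ`, with `t_ρ ∈ (0, 1)`, have the same class, hence
differ by the image of some `y ∈ M_ℝ`. Then `x = -y` has `⟨x, u_ρ⟩ = -D_ρ` on `J` and lies strictly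
between `-D_ρ - 1` and `-D_ρ` off `J`. -/
theorem validityCondition_iff_exists {J : Finset σ.rays} {D : σ.rays → ℤ} {α : σ.rays → ℚ}
    (hα : σ.fInt D = ∑ ρ, (α ρ : ℝ) • σ.β ρ) :
    σ.ValidityCondition J α ↔ ∃ x, σ.negD x = D ∧ σ.integralRays x = J := by
  have hsum : ∀ t : σ.rays → ℝ,
      -∑ ρ ∈ Jᶜ, t ρ • σ.β ρ = σ.fσ fun ρ => if ρ ∈ J then 0 else -t ρ := fun t => by
    have h0 : ∑ ρ ∈ J, (if ρ ∈ J then 0 else -t ρ) • σ.β ρ = 0 :=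
      Finset.sum_eq_zero fun ρ hρ => by rw [if_pos hρ, zero_smul]
    rw [fσ_eq_sum, ← Finset.sum_neg_distrib,
      ← Finset.sum_add_sum_compl J fun ρ => (if ρ ∈ J then 0 else -t ρ) • σ.β ρ, h0, zero_add]
    exact Finset.sum_congr rfl fun ρ hρ => by
      rw [if_neg (Finset.mem_compl.1 hρ), neg_smul]
  simp only [validityCondition_iff, ← hα, hsum, negD_eq_and_integralRays_eq_iff, fInt, fσ_eq_iff]
  constructor
  · rintro ⟨t, ht, y, hy⟩
    have hy' : ∀ ρ, (D ρ : ℝ) = (if ρ ∈ J then 0 else -t ρ) + y ⬝ᵥ toReal ρ.1 :=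
      fun ρ => congrFun hy ρ
    refine ⟨-y, fun ρ hρ => ?_, fun ρ hρ => ?_⟩
    · rw [neg_dotProduct, hy', if_pos hρ, zero_add]
    · rw [neg_dotProduct, hy', if_neg hρ]
      constructor <;> linarith [(ht ρ).1, (ht ρ).2]
  · rintro ⟨x, h1, h2⟩
    refine ⟨fun ρ => if ρ ∈ J then 1 / 2 else -D ρ - x ⬝ᵥ toReal ρ.1, fun ρ => ?_, -x, ?_⟩
    · beta_reduce
      by_cases hρ : ρ ∈ J
      · rw [if_pos hρ]
        norm_num
      · rw [if_neg hρ]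
        constructor <;> linarith [(h2 ρ hρ).1, (h2 ρ hρ).2]
    · ext ρ
      rw [Pi.add_apply, divisorReal_apply, neg_dotProduct]
      by_cases hρ : ρ ∈ J
      · rw [if_pos hρ, h1 ρ hρ]
        ring
      · beta_reduce
        rw [if_neg hρ, if_neg hρ]
        ring

theorem isValidPath_iff {J : Finset σ.rays} {P : σ.ClReal} {v : Fin n → ℝ} :
    σ.IsValidPath J P (σ.fInt (σ.negD v)) ↔ P ∈ σ.latticePoints ∧
      P = σ.fInt (σ.negD v - σ.sumD J) ∧
        ∃ x, σ.negD x = σ.negD v ∧ σ.integralRays x = J := by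
  rw [fInt_sub, fInt_sumD, eq_sub_iff_add_eq]
  constructor
  · rintro ⟨⟨hP, -, h⟩, α, hα, hval⟩
    exact ⟨hP, h, (σ.validityCondition_iff_exists hα).1 hval⟩
  · rintro ⟨hP, h, hx⟩
    have hα : σ.fInt (σ.negD v) = ∑ ρ, (((σ.negD v ρ : ℤ) : ℚ) : ℝ) • σ.β ρ := by
      rw [fInt, fσ_eq_sum]
      simp
    exact ⟨⟨hP, σ.fInt_negD_mem_latticePoints v, h⟩, _, hα,
      (σ.validityCondition_iff_exists hα).2 hx⟩

end ToricCone

/-! ### The proposition -/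

theorem mainTheorem4 {n : ℕ} (k : Type*) [Field k] (σ : ToricCone n) (v : Fin n → ℝ) :
    (∀ P₁ : σ.ClReal,
      (∃ J : Finset σ.rays, σ.IsValidPath J P₁ (σ.fInt (σ.negD v))) ↔
        ∃ w : Fin n → ℝ, σ.Appears k w v ∧ P₁ = σ.fInt (σ.negD w)) ∧
    (∀ (P₁ : σ.ClReal) (J : Finset σ.rays), σ.IsValidPath J P₁ (σ.fInt (σ.negD v)) →
      (∃ w : Fin n → ℝ, σ.LinEquiv (σ.negD w) (σ.negD v - σ.sumD J)) ∧
      ∀ w : Fin n → ℝ, σ.LinEquiv (σ.negD w) (σ.negD v - σ.sumD J) →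
        P₁ = σ.fInt (σ.negD w) ∧ σ.AppearsInDegree k w v (σ.pathLength J)) ∧
    (∀ (w : Fin n → ℝ) (l : ℕ), σ.AppearsInDegree k w v l →
      ∃ J : Finset σ.rays, σ.IsValidPath J (σ.fInt (σ.negD w)) (σ.fInt (σ.negD v)) ∧
        σ.LinEquiv (σ.negD w) (σ.negD v - σ.sumD J) ∧ l = σ.pathLength J) := by
  have h2 : ∀ (P₁ : σ.ClReal) (J : Finset σ.rays),
      σ.IsValidPath J P₁ (σ.fInt (σ.negD v)) →
      (∃ w : Fin n → ℝ, σ.LinEquiv (σ.negD w) (σ.negD v - σ.sumD J)) ∧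
      ∀ w : Fin n → ℝ, σ.LinEquiv (σ.negD w) (σ.negD v - σ.sumD J) →
        P₁ = σ.fInt (σ.negD w) ∧ σ.AppearsInDegree k w v (σ.pathLength J) := by
    intro P J hJ
    obtain ⟨hP, rfl, x, hx, rfl⟩ := σ.isValidPath_iff.1 hJ
    refine ⟨?_, fun w hw => ⟨hw.fInt_eq.symm, (σ.appearsInDegree_iff k).2 ⟨x, hx, rfl, hw⟩⟩⟩
    -- As the starting point lies in `Z`, the divisor `-d(v) - ∑_{ρ ∈ J} D_ρ` is itself some
    -- `-d(w)`, so `m = 0` realises the linear equivalence.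
    obtain ⟨w, hw⟩ := σ.fInt_mem_zonotope_iff.1 hP.1
    exact ⟨w, 0, by rw [hw]; ext ρ; simp [ToricCone.divisor]⟩
  have h3 : ∀ (w : Fin n → ℝ) (l : ℕ), σ.AppearsInDegree k w v l →
      ∃ J : Finset σ.rays, σ.IsValidPath J (σ.fInt (σ.negD w)) (σ.fInt (σ.negD v)) ∧
        σ.LinEquiv (σ.negD w) (σ.negD v - σ.sumD J) ∧ l = σ.pathLength J := by
    intro w l h
    obtain ⟨x, hx, hl, hw⟩ := (σ.appearsInDegree_iff k).1 h
    exact ⟨σ.integralRays x, σ.isValidPath_iff.2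
      ⟨σ.fInt_negD_mem_latticePoints w, hw.fInt_eq, x, hx, rfl⟩, hw, hl⟩
  refine ⟨fun P => ⟨?_, ?_⟩, h2, h3⟩
  · rintro ⟨J, hJ⟩
    obtain ⟨⟨w, hw⟩, h⟩ := h2 P J hJ
    exact ⟨w, ⟨_, (h w hw).2⟩, (h w hw).1⟩
  · rintro ⟨w, ⟨l, hl⟩, rfl⟩
    obtain ⟨J, hJ, -⟩ := h3 w l hl
    exact ⟨J, hJ⟩
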